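/- Let $K$ be a quadratic field of discriminant $d_K<-4$ with maximal order $\mathcal{O}_K$, let $\mathcal{O}=\mathbf{Z}[\tau]$ be a (not necessarily maximal) order in $K$, and let $l$ be a prime not dividing the conductor $[\mathcal{O}_K:\mathcal{O}]$. Let $R=\mathbf{Z}+l\mathcal{O}$, and let $\varphi:\operatorname{cl}(R)\to\operatorname{cl}(\mathcal{O})$ be the homomorphism of ideal class groups (invertible fractional ideals modulo principal ones) that maps $[I]$ to $[I\mathcal{O}]$. For $0\le i\le l-1$ let $J_i$ be the $R$-ideal $$J_i=l^2\mathbf{Z}+l(\tau+i)\mathbf{Z}.$$ Then the $R$-ideal $lR$ together with those $J_i$ that are invertible $R$-ideals form a complete set of representatives for $\ker\varphi$: their classes are pairwise distinct and are exactly the elements of $\ker\varphi$. In particular, $\ker\varphi$ is generated by the class of an invertible $R$-ideal $I$ of norm $[R:I]=l^2$. -/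

import Mathlib

open scoped nonZeroDivisors

noncomputable section

namespace QuadOrder

section InvertibleIdeals

variable (A : Type*) [CommRing A] [IsDomain A]

/-- An ideal is invertible if it is invertible as a fractional ideal. -/
def IsInvertible (I : Ideal A) : Prop :=
  IsUnit (I : FractionalIdeal A⁰ (FractionRing A))

/-- The (integral) invertible ideals of a domain. -/
abbrev InvertibleIdeal : Type _ := {I : Ideal A // IsInvertible A I}

variable {A}

/-- The class `[I]` of an invertible ideal `I` in the ideal class group (invertible fractional
ideals modulo principal ones). -/
def idealClass (I : InvertibleIdeal A) : ClassGroup A :=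
  ClassGroup.mk (FractionRing A) I.2.unit

/-- Nonzero principal ideals are invertible. -/
theorem isInvertible_span_singleton {a : A} (ha : a ≠ 0) :
    IsInvertible A (Ideal.span {a}) := by
  unfold IsInvertible
  rw [FractionalIdeal.coeIdeal_span_singleton]
  have h0 : algebraMap A (FractionRing A) a ≠ 0 := by
    simpa using ha
  exact ⟨toPrincipalIdeal A (FractionRing A) (Units.mk0 _ h0), by simp⟩

end InvertibleIdeals

variable {K : Type*} [Field K]

/-- `O` is an order of the number field `K`: a subring consisting of algebraic integers that
spans `K` over `ℚ`. -/
structure IsOrder [NumberField K] (O : Subalgebra ℤ K) : Prop where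
  isIntegral : ∀ x ∈ O, IsIntegral ℤ x
  span_eq_top : Submodule.span ℚ (O : Set K) = ⊤

/-- The index `[𝓞_K : O]` of an order in the maximal order. -/
def conductor (O : Subalgebra ℤ K) : ℕ :=
  (Subalgebra.toSubmodule O).toAddSubgroup.relIndex
    (Subalgebra.toSubmodule (integralClosure ℤ K)).toAddSubgroup

/-- The order `ℤ + N O`. -/
def suborder (O : Subalgebra ℤ K) (N : ℕ) : Subalgebra ℤ K where
  carrier := {x | ∃ (m : ℤ) (y : K), y ∈ O ∧ x = m + N * y}
  mul_mem' := by
    rintro _ _ ⟨m, y, hy, rfl⟩ ⟨m', y', hy', rfl⟩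
    refine ⟨m * m', m * y' + m' * y + N * (y * y'), ?_, by push_cast; ring⟩
    exact O.add_mem (O.add_mem (O.mul_mem (intCast_mem O m) hy')
      (O.mul_mem (intCast_mem O m') hy)) (O.mul_mem (natCast_mem O N) (O.mul_mem hy hy'))
  add_mem' := by
    rintro _ _ ⟨m, y, hy, rfl⟩ ⟨m', y', hy', rfl⟩
    exact ⟨m + m', y + y', O.add_mem hy hy', by push_cast; ring⟩
  algebraMap_mem' := fun r => ⟨r, 0, O.zero_mem, by simp⟩

theorem suborder_le (O : Subalgebra ℤ K) (N : ℕ) : suborder O N ≤ O := by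
  rintro _ ⟨m, y, hy, rfl⟩
  exact O.add_mem (intCast_mem O m) (O.mul_mem (natCast_mem O N) hy)

/-- The inclusion `ℤ + N O ⊆ O`, as an algebra structure. -/
instance suborderAlgebra (O : Subalgebra ℤ K) (N : ℕ) : Algebra (suborder O N) O :=
  (Subalgebra.inclusion (suborder_le O N)).toRingHom.toAlgebra

instance suborder_isTorsionFree (O : Subalgebra ℤ K) (N : ℕ) :
    Module.IsTorsionFree (suborder O N) O := by
  rw [Module.isTorsionFree_iff_algebraMap_injective]
  exact Subalgebra.inclusion_injective (suborder_le O N)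

/-- The homomorphism `φ : cl(ℤ + N O) → cl(O)`, `[I] ↦ [I O]`. -/
def classMap (O : Subalgebra ℤ K) (N : ℕ) :
    ClassGroup (suborder O N) →* ClassGroup O :=
  ClassGroup.extendedHom (suborder O N) O

/-- An integral element of a quadratic field satisfies a monic integral quadratic equation. -/
theorem exists_quadratic [NumberField K] (h2 : Module.finrank ℚ K = 2) {τ : K}
    (hτ : IsIntegral ℤ τ) : ∃ t n : ℤ, τ ^ 2 = t * τ + n := by
  have hm := minpoly.monic hτ
  have hd : (minpoly ℤ τ).natDegree ≤ 2 := by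
    have h := minpoly.natDegree_le (A := ℚ) τ
    rw [minpoly.isIntegrallyClosed_eq_field_fractions' ℚ hτ, hm.natDegree_map, h2] at h
    exact h
  have h0 : Polynomial.aeval τ (minpoly ℤ τ) = 0 := minpoly.aeval ℤ τ
  have h1 := minpoly.natDegree_pos hτ
  have hlead : (minpoly ℤ τ).coeff (minpoly ℤ τ).natDegree = 1 := hm
  rw [Polynomial.aeval_eq_sum_range] at h0
  obtain hd | hd : (minpoly ℤ τ).natDegree = 1 ∨ (minpoly ℤ τ).natDegree = 2 := by omega
  · rw [hd] at h0 hlead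
    simp only [Finset.sum_range_succ, Finset.sum_range_zero, hlead, zsmul_eq_mul] at h0
    refine ⟨-(minpoly ℤ τ).coeff 0, 0, ?_⟩
    push_cast at h0 ⊢
    linear_combination τ * h0
  · rw [hd] at h0 hlead
    simp only [Finset.sum_range_succ, Finset.sum_range_zero, hlead, zsmul_eq_mul] at h0
    refine ⟨-(minpoly ℤ τ).coeff 1, -(minpoly ℤ τ).coeff 0, ?_⟩
    push_cast at h0 ⊢
    linear_combination h0

/-- If `O = ℤ[τ]` is a quadratic order, then `O = ℤ + ℤ τ`. -/
theorem exists_eq_add_mul [NumberField K] (h2 : Module.finrank ℚ K = 2)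
    {O : Subalgebra ℤ K} (hO : IsOrder O) {τ : K} (hτ : O = Algebra.adjoin ℤ {τ})
    {x : K} (hx : x ∈ O) : ∃ a b : ℤ, x = a + b * τ := by
  obtain ⟨t, n, htn⟩ := exists_quadratic h2
    (hO.isIntegral τ (hτ ▸ Algebra.subset_adjoin (Set.mem_singleton τ)))
  subst hτ
  induction hx using Algebra.adjoin_induction with
  | mem x hx => exact ⟨0, 1, by simp [Set.mem_singleton_iff.mp hx]⟩
  | algebraMap r => exact ⟨r, 0, by simp⟩
  | add x y _ _ hx hy =>
    obtain ⟨a, b, rfl⟩ := hx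
    obtain ⟨c, d, rfl⟩ := hy
    exact ⟨a + c, b + d, by push_cast; ring⟩
  | mul x y _ _ hx hy =>
    obtain ⟨a, b, rfl⟩ := hx
    obtain ⟨c, d, rfl⟩ := hy
    refine ⟨a * c + b * d * n, a * d + b * c + b * d * t, ?_⟩
    push_cast
    linear_combination (b : K) * d * htn

/-- The ideal `J_i = l² ℤ + l (τ + i) ℤ` of the order `R = ℤ + l O`, where `O = ℤ[τ]` is an order
in a quadratic field. -/
def idealJ [NumberField K] (h2 : Module.finrank ℚ K = 2) {O : Subalgebra ℤ K} (hO : IsOrder O)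
    {τ : K} (hτ : O = Algebra.adjoin ℤ {τ}) (l i : ℕ) : Ideal (suborder O l) where
  carrier := {x | ∃ a b : ℤ, (x : K) = l ^ 2 * a + l * (τ + i) * b}
  zero_mem' := ⟨0, 0, by simp⟩
  add_mem' := by
    rintro x y ⟨a, b, h⟩ ⟨c, d, h'⟩
    exact ⟨a + c, b + d, by push_cast; rw [h, h']; ring⟩
  smul_mem' := by
    rintro ⟨_, m, y, hy, rfl⟩ x ⟨a, b, h⟩
    have hτO : τ ∈ O := hτ ▸ Algebra.subset_adjoin (Set.mem_singleton τ)
    have hz : y * (l * a + (τ + i) * b) ∈ O :=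
      O.mul_mem hy (O.add_mem (O.mul_mem (natCast_mem O l) (intCast_mem O a))
        (O.mul_mem (O.add_mem hτO (natCast_mem O i)) (intCast_mem O b)))
    obtain ⟨e, f, hef⟩ := exists_eq_add_mul h2 hO hτ hz
    refine ⟨m * a + e - f * i, m * b + l * f, ?_⟩
    push_cast [smul_eq_mul]
    rw [h]
    linear_combination (l : K) ^ 2 * hef

/-- As a subset of `K`, the ideal `J_i` is the whole lattice spanned by `l²` and `l (τ + i)`. -/
theorem coe_idealJ [NumberField K] (h2 : Module.finrank ℚ K = 2) {O : Subalgebra ℤ K}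
    (hO : IsOrder O) {τ : K} (hτ : O = Algebra.adjoin ℤ {τ}) (l i : ℕ) :
    (fun x : suborder O l => (x : K)) '' (idealJ h2 hO hτ l i : Set (suborder O l)) =
      (Submodule.span ℤ {(l : K) ^ 2, (l : K) * (τ + i)} : Set K) := by
  have hτO : τ ∈ O := hτ ▸ Algebra.subset_adjoin (Set.mem_singleton τ)
  ext z
  simp only [SetLike.mem_coe, Submodule.mem_span_pair, zsmul_eq_mul]
  constructor
  · rintro ⟨x, ⟨a, b, h⟩, rfl⟩
    exact ⟨a, b, by simp only [h]; ring⟩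
  · rintro ⟨a, b, rfl⟩
    refine ⟨⟨_, 0, l * a + (τ + i) * b, ?_, ?_⟩, ⟨a, b, ?_⟩, rfl⟩
    · exact O.add_mem (O.mul_mem (natCast_mem O l) (intCast_mem O a))
        (O.mul_mem (O.add_mem hτO (natCast_mem O i)) (intCast_mem O b))
    · push_cast; ring
    · simp only; ring

/-- The ideal `l R` of `R = ℤ + l O`, an invertible ideal. -/
def idealL [NumberField K] (O : Subalgebra ℤ K) {l : ℕ} (hl : l ≠ 0) :
    InvertibleIdeal (suborder O l) :=
  ⟨Ideal.span {(l : suborder O l)}, isInvertible_span_singleton (Nat.cast_ne_zero.mpr hl)⟩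

/-- The family consisting of `l R` (index `none`) and of those ideals `J_i`, `0 ≤ i < l`, that are
invertible `R`-ideals. -/
def representative [NumberField K] (h2 : Module.finrank ℚ K = 2) {O : Subalgebra ℤ K}
    (hO : IsOrder O) {τ : K} (hτ : O = Algebra.adjoin ℤ {τ}) {l : ℕ} (hl : l ≠ 0) :
    Option {i : Fin l // IsInvertible (suborder O l) (idealJ h2 hO hτ l i)} →
      InvertibleIdeal (suborder O l)
  | none => idealL O hl
  | some i => ⟨idealJ h2 hO hτ l i.1, i.2⟩

end QuadOrder

end

namespace QuadOrder

/-! ### Invertible ideals, their classes and their extension to a larger ring -/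

section InvertibleIdeals

variable {A : Type*} [CommRing A]

/-! Let `I` be an invertible `R`-ideal with `IO = αO`. The lattice `S = α⁻¹I` lies between `lO` and
`O`. It is not `O`, since an invertible `R`-ideal is not stable under `τ`
(`IsInvertible.not_stable`), and it is not `lO`, since `SO = O`. So `S/lO` is a line in `O/lO ≅
𝔽_l²`: the line through `1` gives `S = R`, the line through `τ + i` gives `lS = J_i`. This is
`exists_representative`.

Conversely every representative extends to `lO` (`map_idealJ`). As `d_K < -4`, the units of `O` are
`±1`, so ideals of the same class with the same principal extension coincide
(`eq_of_idealClass_eq`). Hence distinct representatives have distinct classes.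

The same rigidity turns `[J_i]^n = 1` into `J_i^n = l^n R`, whence `(τ + i)^n ∈ R`. The
`τ`-coordinate of `(τ + i)^n` is a polynomial in `i` of degree `n - 1` with leading coefficient `n`;
for `0 < n < l` it has at most `n - 1` roots mod `l`. With the trivial class, `g^n = 1` has at most
`n` solutions in the kernel. Its order is at most `l + 1`, so proper divisors of the order are below
`l`, and the kernel is cyclic. -/

theorem isInvertible_mul_iff {I J : Ideal A} :
    IsInvertible A (I * J) ↔ IsInvertible A I ∧ IsInvertible A J := by
  unfold IsInvertible
  rw [FractionalIdeal.coeIdeal_mul, IsUnit.mul_iff]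

theorem IsInvertible.pow {I : Ideal A} (hI : IsInvertible A I) (n : ℕ) :
    IsInvertible A (I ^ n) := by
  unfold IsInvertible at *
  rw [FractionalIdeal.coeIdeal_pow]
  exact hI.pow n

variable [IsDomain A]

theorem idealClass_pow {I : Ideal A} (hI : IsInvertible A I) (n : ℕ) :
    idealClass ⟨I, hI⟩ ^ n = idealClass ⟨I ^ n, hI.pow n⟩ := by
  unfold idealClass
  rw [← map_pow]
  congr 1
  ext1
  exact (congrArg (· ^ n) hI.unit_spec).trans <|
    (FractionalIdeal.coeIdeal_pow _ _ I n).symm.trans (hI.pow n).unit_spec.symm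

theorem idealClass_eq_iff {I J : InvertibleIdeal A} :
    idealClass I = idealClass J ↔
      ∃ x y : A, x ≠ 0 ∧ y ≠ 0 ∧ Ideal.span {x} * I.1 = Ideal.span {y} * J.1 :=
  ClassGroup.mk_eq_mk_of_coe_ideal I.2.unit_spec J.2.unit_spec

theorem idealClass_eq_one_iff {I : InvertibleIdeal A} :
    idealClass I = 1 ↔ ∃ x : A, x ≠ 0 ∧ I.1 = Ideal.span {x} :=
  ClassGroup.mk_eq_one_of_coe_ideal I.2.unit_spec

/-- Clearing denominators in the inverse keeps later arguments among integral ideals. -/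
theorem IsInvertible.exists_mul_eq_span_singleton {I : Ideal A} (hI : IsInvertible A I) :
    ∃ (J : Ideal A) (a : A), a ≠ 0 ∧ I * J = Ideal.span {a} := by
  obtain ⟨u, hu⟩ := hI
  obtain ⟨a, J, ha, hJ⟩ := FractionalIdeal.exists_eq_spanSingleton_mul
    ((u⁻¹ : (FractionalIdeal A⁰ (FractionRing A))ˣ) : FractionalIdeal A⁰ (FractionRing A))
  refine ⟨J, a, ha, ?_⟩
  have ha' : algebraMap A (FractionRing A) a ≠ 0 := by simpa using ha
  have h := u.mul_inv
  rw [hJ, hu] at h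
  refine FractionalIdeal.coeIdeal_injective (K := FractionRing A) ?_
  dsimp only
  rw [FractionalIdeal.coeIdeal_mul, FractionalIdeal.coeIdeal_span_singleton]
  calc (I : FractionalIdeal A⁰ (FractionRing A)) * J
      = FractionalIdeal.spanSingleton A⁰ (algebraMap A (FractionRing A) a) *
        (I * (FractionalIdeal.spanSingleton A⁰ (algebraMap A (FractionRing A) a)⁻¹ * J)) := by
        rw [mul_left_comm (I : FractionalIdeal A⁰ (FractionRing A)), ← mul_assoc,
          FractionalIdeal.spanSingleton_mul_spanSingleton, mul_inv_cancel₀ ha',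
          FractionalIdeal.spanSingleton_one, one_mul]
    _ = _ := by rw [h, mul_one]

theorem idealClass_surjective : Function.Surjective (idealClass (A := A)) := by
  intro c
  refine ClassGroup.induction (FractionRing A) (fun u => ?_) c
  obtain ⟨a, J, ha, hJ⟩ := FractionalIdeal.exists_eq_spanSingleton_mul
    (u : FractionalIdeal A⁰ (FractionRing A))
  have ha' : algebraMap A (FractionRing A) a ≠ 0 := by simpa using ha
  have h1 : (J : FractionalIdeal A⁰ (FractionRing A)) =
      FractionalIdeal.spanSingleton A⁰ (algebraMap A (FractionRing A) a) * u := by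
    rw [hJ, ← mul_assoc, FractionalIdeal.spanSingleton_mul_spanSingleton, mul_inv_cancel₀ ha',
      FractionalIdeal.spanSingleton_one, one_mul]
  have h2 : (J : FractionalIdeal A⁰ (FractionRing A)) =
      ↑(u * toPrincipalIdeal A (FractionRing A) (Units.mk0 _ ha')) := by
    rw [h1, Units.val_mul, coe_toPrincipalIdeal, Units.val_mk0, mul_comm]
  have hinv : IsInvertible A J := by
    unfold IsInvertible
    rw [h2]
    exact Units.isUnit _
  refine ⟨⟨J, hinv⟩, (ClassGroup.mk_eq_mk.mpr ⟨Units.mk0 _ ha', ?_⟩).symm⟩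
  ext1
  rw [← h2, hinv.unit_spec]

theorem IsInvertible.map {B : Type*} [CommRing B] [IsDomain B] [Algebra A B]
    [Module.IsTorsionFree A B] {I : Ideal A} (hI : IsInvertible A I) :
    IsInvertible B (I.map (algebraMap A B)) := by
  unfold IsInvertible at *
  rw [← FractionalIdeal.extendedHom_coeIdeal_eq_map (K := FractionRing A)]
  exact hI.map _

theorem extendedHom_idealClass {B : Type*} [CommRing B] [IsDomain B] [Algebra A B]
    [Module.IsTorsionFree A B] (I : InvertibleIdeal A) :
    ClassGroup.extendedHom A B (idealClass I) =
      idealClass ⟨I.1.map (algebraMap A B), I.2.map⟩ := by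
  unfold idealClass
  rw [ClassGroup.extendedHom_mk]
  congr 1
  ext1
  exact (congrArg (FractionalIdeal.extendedHom (FractionRing B) B) I.2.unit_spec).trans <|
    (FractionalIdeal.extendedHom_coeIdeal_eq_map _ B I.1).trans I.2.map.unit_spec.symm

end InvertibleIdeals

/-! ### Units of the maximal order -/

section Units

/-- The discriminant of `1, u` in a ring that is free of rank two over the integers. -/
theorem trace_sq_sub_four_norm {S : Type*} [CommRing S] [IsDomain S]
    (b : Module.Basis (Fin 2) ℤ S) (u : S) :
    (∃ D : ℤ, Algebra.trace ℤ S u ^ 2 - 4 * Algebra.norm ℤ u = D ^ 2 * Algebra.discr ℤ b) ∧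
      u ^ 2 = Algebra.trace ℤ S u * u - Algebra.norm ℤ u := by
  set M := Algebra.leftMulMatrix b u with hM
  have htr : Algebra.trace ℤ S u = M 0 0 + M 1 1 := by
    rw [Algebra.trace_eq_matrix_trace b, Matrix.trace_fin_two]
  have hnorm : Algebra.norm ℤ u = M 0 0 * M 1 1 - M 0 1 * M 1 0 := by
    rw [Algebra.norm_eq_matrix_det b, Matrix.det_fin_two]
  have htr2 : Algebra.trace ℤ S (u * u) =
      M 0 0 * M 0 0 + M 0 1 * M 1 0 + (M 1 0 * M 0 1 + M 1 1 * M 1 1) := by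
    rw [Algebra.trace_eq_matrix_trace b, map_mul, Matrix.trace_fin_two, Matrix.mul_apply,
      Matrix.mul_apply, Fin.sum_univ_two, Fin.sum_univ_two]
  have htr1 : Algebra.trace ℤ S 1 = 2 := by
    rw [Algebra.trace_eq_matrix_trace b, map_one, Matrix.trace_one, Fintype.card_fin]; rfl
  constructor
  · let v : Fin 2 → S := ![1, u]
    let P : Matrix (Fin 2) (Fin 2) ℤ := Matrix.of fun i j => b.repr (v j) i
    have hv : v = Matrix.vecMul b (P.map (algebraMap ℤ S)) := by
      ext j
      rw [← b.sum_repr (v j)]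
      simp [Matrix.vecMul, dotProduct, P, mul_comm]
    -- The columns of `P` are the coordinates of `1` and `u`, so `D` is the determinant of the base
    -- change.
    refine ⟨P.det, ?_⟩
    rw [← Algebra.discr_of_matrix_vecMul b P, ← hv, Algebra.discr_def, Matrix.det_fin_two]
    simp only [Algebra.traceMatrix_apply, Algebra.traceForm_apply, v, Matrix.cons_val_zero,
      Matrix.cons_val_one, mul_one, one_mul, htr1, htr2, htr, hnorm]
    ring
  -- Cayley–Hamilton for the matrix of multiplication by `u`.
  · apply Algebra.leftMulMatrix_injective b
    rw [htr, hnorm, map_sub, map_mul, map_pow, ← hM]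
    simp only [map_intCast]
    ext i j
    fin_cases i <;> fin_cases j <;>
      simp [pow_two, Matrix.mul_apply, Fin.sum_univ_two, Matrix.intCast_apply] <;> ring

/-- The only units of the maximal order of a quadratic field of discriminant less than `-4`
are `1` and `-1`. -/
theorem eq_one_or_neg_one_of_isUnit {K : Type*} [Field K] [NumberField K]
    (h2 : Module.finrank ℚ K = 2) (hd : NumberField.discr K < -4)
    {u : NumberField.RingOfIntegers K} (hu : IsUnit u) : u = 1 ∨ u = -1 := by
  have hcard : Fintype.card (Module.Free.ChooseBasisIndex ℤ (NumberField.RingOfIntegers K)) = 2 := by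
    rw [← Module.finrank_eq_card_chooseBasisIndex, NumberField.RingOfIntegers.rank, h2]
  let e := Fintype.equivFinOfCardEq hcard
  let b := (NumberField.RingOfIntegers.basis K).reindex e
  have hb : Algebra.discr ℤ b = NumberField.discr K := by
    rw [NumberField.discr, ← Algebra.discr_reindex ℤ _ e]
    congr 1
    ext i
    simp [b]
  obtain ⟨⟨D, hD⟩, hsq⟩ := trace_sq_sub_four_norm b u
  rw [hb] at hD
  have hn : IsUnit (Algebra.norm ℤ u) := hu.map _
  set t := Algebra.trace ℤ _ u
  -- Otherwise `t² - 4N(u) ≤ d_K < -4`, whereas `N(u) = ±1` makes the left side at least `-4`.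
  have hD0 : D = 0 := by
    by_contra hne
    have h1 : 1 ≤ D ^ 2 := Int.add_one_le_iff.mpr (sq_pos_of_ne_zero hne)
    rcases Int.isUnit_iff.mp hn with h | h <;> rw [h] at hD <;> nlinarith [sq_nonneg t]
  rw [hD0] at hD
  rcases Int.isUnit_iff.mp hn with h | h <;> rw [h] at hD hsq
  · have ht : (t - 2) * (t + 2) = 0 := by linarith
    rcases mul_eq_zero.mp ht with ht | ht
    · left
      have : t = 2 := by linarith
      rw [this] at hsq
      refine sub_eq_zero.mp (pow_eq_zero_iff two_ne_zero |>.mp ?_)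
      push_cast at hsq
      linear_combination hsq
    · right
      have : t = -2 := by linarith
      rw [this] at hsq
      refine eq_neg_iff_add_eq_zero.mpr (pow_eq_zero_iff two_ne_zero |>.mp ?_)
      push_cast at hsq
      linear_combination hsq
  · nlinarith [sq_nonneg t]

end Units

/-! ### Coordinates in `ℤ[τ]`, stability under `τ`, and the extension of `J_i` -/

section Order

variable {K : Type*} [Field K] [NumberField K]

theorem isIntegral_le {O : Subalgebra ℤ K} (hO : IsOrder O) : O ≤ integralClosure ℤ K :=
  fun x hx => hO.isIntegral x hx

theorem eq_one_or_neg_one_of_isUnit_order (h2 : Module.finrank ℚ K = 2)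
    (hd : NumberField.discr K < -4) {O : Subalgebra ℤ K} (hO : IsOrder O) {u : O}
    (hu : IsUnit u) : u = 1 ∨ u = -1 := by
  have h := eq_one_or_neg_one_of_isUnit h2 hd
    (u := Subalgebra.inclusion (isIntegral_le hO) u) (hu.map (Subalgebra.inclusion _))
  refine h.imp (fun h => ?_) (fun h => ?_)
  · exact Subalgebra.inclusion_injective (isIntegral_le hO) (h.trans (map_one _).symm)
  · exact Subalgebra.inclusion_injective (isIntegral_le hO)
      (h.trans ((map_neg _ _).trans (congrArg _ (map_one _))).symm)

/-- Ideals of `ℤ + N O` in the same class and with the same principal extension to `O` agree. -/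
theorem eq_of_idealClass_eq (h2 : Module.finrank ℚ K = 2) (hd : NumberField.discr K < -4)
    {O : Subalgebra ℤ K} (hO : IsOrder O) {N : ℕ} {I J : InvertibleIdeal (suborder O N)}
    {c : O} (hc : c ≠ 0) (hI : I.1.map (algebraMap (suborder O N) O) = Ideal.span {c})
    (hJ : J.1.map (algebraMap (suborder O N) O) = Ideal.span {c})
    (h : idealClass I = idealClass J) : I.1 = J.1 := by
  obtain ⟨x, y, hx, hy, hxy⟩ := idealClass_eq_iff.mp h
  -- Over `O` the factor `c` cancels, so `x` and `y` differ by a unit of `O`, that is by a sign.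
  have h1 := congrArg (Ideal.map (algebraMap (suborder O N) O)) hxy
  rw [Ideal.map_mul, Ideal.map_mul, hI, hJ, Ideal.map_span, Ideal.map_span, Set.image_singleton,
    Set.image_singleton, mul_comm, mul_comm _ (Ideal.span {c}),
    Ideal.span_singleton_mul_right_inj hc, Ideal.span_singleton_eq_span_singleton] at h1
  obtain ⟨u, hu⟩ := h1
  have hinj : Function.Injective (algebraMap (suborder O N) O) :=
    Subalgebra.inclusion_injective (suborder_le O N)
  have hspan : Ideal.span {y} = Ideal.span {x} := by
    rcases eq_one_or_neg_one_of_isUnit_order h2 hd hO u.isUnit with h | h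
    · rw [h, mul_one] at hu
      rw [hinj hu]
    · rw [h, mul_neg, mul_one, ← map_neg] at hu
      rw [← hinj hu, Ideal.span_singleton_neg]
  rw [hspan, Ideal.span_singleton_mul_right_inj hx] at hxy
  exact hxy

variable {O : Subalgebra ℤ K} {τ : K}

omit [NumberField K] in
theorem generator_mem (hτ : O = Algebra.adjoin ℤ {τ}) : τ ∈ O :=
  hτ ▸ Algebra.subset_adjoin (Set.mem_singleton τ)

omit [NumberField K] in
theorem add_mul_mem (hτ : O = Algebra.adjoin ℤ {τ}) (a b : ℤ) : (a + b * τ : K) ∈ O :=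
  O.add_mem (intCast_mem O a) (O.mul_mem (intCast_mem O b) (generator_mem hτ))

variable (h2 : Module.finrank ℚ K = 2) (hO : IsOrder O) (hτ : O = Algebra.adjoin ℤ {τ})

include h2 hO hτ

/-- A rational `τ` would confine the `ℚ`-span of `O` to `ℚ`. This makes coordinates with respect to
`1, τ` unique. -/
theorem generator_notMem_bot : τ ∉ (⊥ : Subalgebra ℚ K) := by
  intro h
  have hle : (O : Set K) ⊆ (Subalgebra.toSubmodule (⊥ : Subalgebra ℚ K) : Set K) := by
    intro x hx
    obtain ⟨a, b, rfl⟩ := exists_eq_add_mul h2 hO hτ hx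
    exact (⊥ : Subalgebra ℚ K).add_mem (intCast_mem _ a) (mul_mem (intCast_mem _ b) h)
  have htop := Submodule.span_le.mpr hle
  rw [hO.span_eq_top, top_le_iff, Algebra.toSubmodule_eq_top,
    Subalgebra.bot_eq_top_iff_finrank_eq_one] at htop
  omega

theorem add_mul_eq_zero {a b : ℤ} (h : (a + b * τ : K) = 0) : a = 0 ∧ b = 0 := by
  have hb : b = 0 := by
    by_contra hb
    apply generator_notMem_bot h2 hO hτ
    have hb' : (b : K) ≠ 0 := Int.cast_ne_zero.mpr hb
    refine Algebra.mem_bot.mpr ⟨-a / b, ?_⟩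
    rw [map_div₀, map_neg, map_intCast, map_intCast]
    field_simp
    linear_combination -h
  subst hb
  simpa using h

theorem add_mul_inj {a b c d : ℤ} (h : (a + b * τ : K) = c + d * τ) : a = c ∧ b = d := by
  have := add_mul_eq_zero h2 hO hτ (a := a - c) (b := b - d)
    (by push_cast; linear_combination h)
  omega

theorem add_mul_mem_suborder_iff {l : ℕ} {a b : ℤ} :
    (a + b * τ : K) ∈ suborder O l ↔ (l : ℤ) ∣ b := by
  constructor
  · rintro ⟨m, y, hy, h⟩
    obtain ⟨c, d, rfl⟩ := exists_eq_add_mul h2 hO hτ hy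
    exact ⟨d, (add_mul_inj h2 hO hτ (a := a) (b := b) (c := m + l * c) (d := l * d)
      (by push_cast; linear_combination h)).2⟩
  · rintro ⟨d, rfl⟩
    exact ⟨a, d * τ, O.mul_mem (intCast_mem O d) (generator_mem hτ), by push_cast; ring⟩

theorem generator_notMem_suborder {l : ℕ} (hl : l ≠ 1) : τ ∉ suborder O l := by
  intro h
  have := (add_mul_mem_suborder_iff h2 hO hτ (l := l) (a := 0) (b := 1)).mp (by simpa using h)
  exact hl (Int.natCast_dvd_natCast.mp (by simpa using this) |> Nat.dvd_one.mp)

/-- An invertible ideal of `ℤ + l O` is not an `O`-module. -/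
theorem IsInvertible.not_stable {l : ℕ} (hl : l ≠ 1) {I : Ideal (suborder O l)}
    (hI : IsInvertible (suborder O l) I) :
    ¬ ∀ x ∈ I, ∃ y ∈ I, (y : K) = τ * x := by
  intro h
  obtain ⟨J, a, ha, hIJ⟩ := hI.exists_mul_eq_span_singleton
  -- Stability passes to `I * J = aR`; then `τa ∈ aR` forces `τ ∈ R`.
  have key : ∀ z ∈ I * J, ∃ w ∈ I * J, (w : K) = τ * z := by
    intro z hz
    induction hz using Submodule.mul_induction_on' with
    | mem_mul_mem m hm n hn =>
      obtain ⟨y, hy, hym⟩ := h m hm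
      exact ⟨y * n, Ideal.mul_mem_mul hy hn, by push_cast; rw [hym, mul_assoc]⟩
    | add x _ y _ hx hy =>
      obtain ⟨v, hv, hvx⟩ := hx
      obtain ⟨w, hw, hwy⟩ := hy
      exact ⟨v + w, add_mem hv hw, by push_cast; rw [hvx, hwy, mul_add]⟩
  obtain ⟨w, hw, hwa⟩ := key a (hIJ ▸ Ideal.mem_span_singleton_self a)
  rw [hIJ, Ideal.mem_span_singleton'] at hw
  obtain ⟨r, rfl⟩ := hw
  have ha' : (a : K) ≠ 0 := fun h0 => ha (Subtype.ext h0)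
  have : (r : K) = τ := mul_right_cancel₀ ha' (by simpa using hwa)
  exact generator_notMem_suborder h2 hO hτ hl (this ▸ r.2)

/-- The extension contains `l²` and `l N(τ + i)`, and invertibility makes the norm prime to `l`. -/
theorem map_idealJ {l : ℕ} (hl : l.Prime) {i : ℕ}
    (hI : IsInvertible (suborder O l) (idealJ h2 hO hτ l i)) :
    (idealJ h2 hO hτ l i).map (algebraMap (suborder O l) O) = Ideal.span {(l : O)} := by
  have hτO := generator_mem hτ
  obtain ⟨t, n, htn⟩ := exists_quadratic h2 (hO.isIntegral τ hτO)
  apply le_antisymm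
  · rw [Ideal.map_le_iff_le_comap]
    rintro x ⟨a, b, hx⟩
    rw [Ideal.mem_comap, Ideal.mem_span_singleton']
    refine ⟨⟨(l * a + i * b : ℤ) + (b : ℤ) * τ, add_mul_mem hτ _ _⟩, Subtype.ext ?_⟩
    change _ * (l : K) = (x : K)
    rw [hx]
    push_cast
    ring
  · have hmem : ∀ a b : ℤ, (⟨(l : K) ^ 2 * a + l * (τ + i) * b, O.add_mem
        (O.mul_mem (pow_mem (natCast_mem O l) 2) (intCast_mem O a))
        (O.mul_mem (O.mul_mem (natCast_mem O l) (O.add_mem hτO (natCast_mem O i)))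
          (intCast_mem O b))⟩ : O) ∈
        (idealJ h2 hO hτ l i).map (algebraMap (suborder O l) O) := by
      intro a b
      refine Ideal.mem_map_of_mem (algebraMap (suborder O l) O)
        (x := ⟨(l : K) ^ 2 * a + l * (τ + i) * b,
          0, ((l * a + i * b : ℤ) : K) + b * τ, add_mul_mem hτ _ _, by push_cast; ring⟩) ?_
      exact ⟨a, b, rfl⟩
    -- This integer is the norm of `τ + i`. If it were `lk`, then `τ · l(τ + i) = l(t + i)(τ + i) -
    -- l²k`, and `J_i` would be stable under `τ`.
    have hN : ¬ (l : ℤ) ∣ i ^ 2 + i * t - n := by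
      rintro ⟨k, hk⟩
      have hk' : (i : K) ^ 2 + i * t - n = l * k := by exact_mod_cast congrArg (Int.cast : ℤ → K) hk
      refine hI.not_stable h2 hO hτ hl.ne_one ?_
      rintro x ⟨a, b, hx⟩
      refine ⟨⟨l ^ 2 * (-i * a - k * b : ℤ) + l * (τ + i) * (l * a + (t + i) * b : ℤ), 0,
        ((l * (-i * a - k * b) + i * (l * a + (t + i) * b) : ℤ) : K) +
          (l * a + (t + i) * b : ℤ) * τ, add_mul_mem hτ _ _, by push_cast; ring⟩, ⟨_, _, rfl⟩, ?_⟩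
      rw [hx]
      push_cast
      linear_combination - (l : K) * b * htn + (l : K) * b * hk'
    obtain ⟨u, v, huv⟩ := (Nat.prime_iff_prime_int.mp hl).irreducible.coprime_iff_not_dvd.mpr hN
    have huv' : (u : K) * l + v * (i ^ 2 + i * t - n) = 1 := by
      exact_mod_cast congrArg (Int.cast : ℤ → K) huv
    rw [Ideal.span_singleton_le_iff_mem]
    -- The multiplier `t + i - τ` is the conjugate of `τ + i`, so the sum is `l(ul + v N(τ + i)) =
    -- l`.
    have h1 := Ideal.add_mem _ (hmem u 0) (Ideal.mul_mem_left _
      ⟨((t + i : ℤ) : K) + (-1 : ℤ) * τ, add_mul_mem hτ _ _⟩ (hmem 0 v))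
    convert h1 using 1
    apply Subtype.ext
    change (l : K) = _ + _ * _
    push_cast
    linear_combination - (l : K) * huv' + (l : K) * v * htn

end Order

/-! ### Every class in the kernel has a representative -/

section Kernel

variable {K : Type*} [Field K] [NumberField K] {O : Subalgebra ℤ K} {τ : K}

omit [NumberField K] in
/-- `l O` multiplies the extension of an ideal of `ℤ + l O` back into the ideal. -/
theorem exists_mem_eq_mul_of_mem_map {l : ℕ} {I : Ideal (suborder O l)} {w : O}
    (hw : w ∈ I.map (algebraMap (suborder O l) O)) :
    ∀ o : O, ∃ x ∈ I, (x : K) = l * o * w := by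
  induction hw using Submodule.span_induction with
  | mem w hw =>
    obtain ⟨x, hx, rfl⟩ := hw
    intro o
    exact ⟨⟨l * o, 0, o, o.2, by simp⟩ * x, I.mul_mem_left _ hx, rfl⟩
  | zero => exact fun o => ⟨0, I.zero_mem, by simp⟩
  | add v w _ _ hv hw =>
    intro o
    obtain ⟨x, hx, hxv⟩ := hv o
    obtain ⟨y, hy, hyw⟩ := hw o
    exact ⟨x + y, I.add_mem hx hy, by push_cast; rw [hxv, hyw, mul_add]⟩
  | smul a w _ hw =>
    intro o
    obtain ⟨x, hx, hxw⟩ := hw (o * a)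
    exact ⟨x, hx, by rw [hxw, smul_eq_mul]; push_cast; ring⟩

theorem idealClass_idealL (O : Subalgebra ℤ K) {l : ℕ} (hl : l ≠ 0) :
    idealClass (idealL O hl) = 1 :=
  idealClass_eq_one_iff.mpr ⟨(l : suborder O l), Nat.cast_ne_zero.mpr hl, rfl⟩

variable (h2 : Module.finrank ℚ K = 2) (hO : IsOrder O) (hτ : O = Algebra.adjoin ℤ {τ})

/-- An invertible ideal of `ℤ + l O` whose extension to `O` is principal is equivalent to `l R` or
to one of the invertible `J_i`. -/
theorem exists_representative {l : ℕ} (hl : l.Prime) (I : InvertibleIdeal (suborder O l))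
    {α : O} (hα : α ≠ 0) (hI : I.1.map (algebraMap (suborder O l) O) = Ideal.span {α}) :
    ∃ r, idealClass (representative h2 hO hτ hl.ne_zero r) = idealClass I := by
  have hα' : (α : K) ≠ 0 := fun h => hα (Subtype.ext h)
  have hl' : (l : K) ≠ 0 := Nat.cast_ne_zero.mpr hl.ne_zero
  have hlZ := (Nat.prime_iff_prime_int.mp hl).irreducible
  have hτO := generator_mem hτ
  -- Membership in `α⁻¹I`; `hS` and `hlO` place this lattice between `lO` and `O`.
  let S : K → Prop := fun z => ∃ x ∈ I.1, (x : K) = α * z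
  have hS : ∀ x ∈ I.1, ∃ a b : ℤ, (x : K) = α * (a + b * τ) := by
    intro x hx
    have h := Ideal.mem_map_of_mem (algebraMap (suborder O l) O) hx
    rw [hI, Ideal.mem_span_singleton'] at h
    obtain ⟨o, ho⟩ := h
    obtain ⟨a, b, hab⟩ := exists_eq_add_mul h2 hO hτ o.2
    refine ⟨a, b, ?_⟩
    have h1 : (o : K) * α = x := congrArg Subtype.val ho
    rw [← h1, hab, mul_comm]
  have hadd : ∀ {y z}, S y → S z → S (y + z) := by
    rintro y z ⟨v, hv, hvy⟩ ⟨w, hw, hwz⟩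
    exact ⟨v + w, I.1.add_mem hv hw, by push_cast; rw [hvy, hwz, mul_add]⟩
  have hmul : ∀ {z} (m : ℤ), S z → S (m * z) := by
    rintro z m ⟨w, hw, hwz⟩
    exact ⟨m * w, I.1.mul_mem_left _ hw, by push_cast; rw [hwz]; ring⟩
  have hlO : ∀ a b : ℤ, S (l * (a + b * τ)) := by
    intro a b
    obtain ⟨x, hx, hxa⟩ := exists_mem_eq_mul_of_mem_map
      (hI ▸ Ideal.mem_span_singleton_self α) ⟨a + b * τ, add_mul_mem hτ a b⟩
    exact ⟨x, hx, by rw [hxa]; push_cast; ring⟩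
  -- Otherwise `S` is all of `O` and `I = αO` is stable under `τ`.
  have hnot : S 1 → ¬ S τ := by
    intro h1 hSτ
    refine I.2.not_stable h2 hO hτ hl.ne_one fun x hx => ?_
    obtain ⟨a, b, hab⟩ := hS x hx
    obtain ⟨c, d, hcd⟩ := exists_eq_add_mul h2 hO hτ (O.mul_mem hτO (add_mul_mem hτ a b))
    obtain ⟨y, hy, hyx⟩ := hadd (hmul c h1) (hmul d hSτ)
    exact ⟨y, hy, by rw [hyx, hab]; linear_combination -(α : K) * hcd⟩
  have hone : ∀ m : ℤ, S m → ¬ (l : ℤ) ∣ m → S 1 := by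
    intro m hm hlm
    obtain ⟨u, v, huv⟩ := hlZ.coprime_iff_not_dvd.mpr hlm
    have huv' : (u : K) * l + v * m = 1 := by exact_mod_cast congrArg (Int.cast : ℤ → K) huv
    have h := hadd (hlO u 0) (hmul v hm)
    rwa [show (l : K) * (u + (0 : ℤ) * τ) + v * m = 1 by
      push_cast; linear_combination huv'] at h
  by_cases hcase : ∃ b c : ℤ, ¬ (l : ℤ) ∣ c ∧ S (b + c * τ)
  · obtain ⟨b, c, hlc, hbc⟩ := hcase
    -- With `v` inverse to `c` mod `l` and `i ≡ vb`, the multiple `v(b + cτ)` is congruent to `τ +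
    -- i` mod `lO`.
    obtain ⟨u, v, huv⟩ := hlZ.coprime_iff_not_dvd.mpr hlc
    have huv' : (u : K) * l + v * c = 1 := by exact_mod_cast congrArg (Int.cast : ℤ → K) huv
    have hlpos : (0 : ℤ) < l := by exact_mod_cast hl.pos
    obtain ⟨i, hi⟩ : ∃ i : ℕ, (i : ℤ) = v * b % l :=
      ⟨_, Int.toNat_of_nonneg (Int.emod_nonneg _ hlpos.ne')⟩
    have hil : i < l := by
      have := Int.emod_lt_of_pos (v * b) hlpos
      omega
    have hib : (i : K) + l * (v * b / l : ℤ) = v * b := by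
      exact_mod_cast congrArg (Int.cast : ℤ → K) (hi ▸ Int.emod_add_mul_ediv (v * b) l)
    have hτi : S (τ + i) := by
      have h := hadd (hmul v hbc) (hlO (-(v * b / l)) u)
      convert h using 1
      rw [Int.cast_neg]
      linear_combination hib - τ * huv'
    have hS1 : ¬ S 1 := by
      intro h1
      refine hnot h1 ?_
      have h := hadd hτi (hmul (-i) h1)
      convert h using 1
      push_cast
      ring
    -- Subtracting `b(τ + i)` leaves an integer of `S`, which `l` must divide as `1 ∉ S`.
    have hcoord : ∀ a b : ℤ, S (a + b * τ) → (l : ℤ) ∣ a - b * i := by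
      intro a b hab
      by_contra hndvd
      refine hS1 (hone _ ?_ hndvd)
      have h := hadd hab (hmul (-b) hτi)
      convert h using 1
      push_cast
      ring
    let lα : suborder O l := ⟨l * α, 0, α, α.2, by simp⟩
    have hlα : lα ≠ 0 := fun h => mul_ne_zero hl' hα' (congrArg Subtype.val h)
    have hl2 : (l ^ 2 : suborder O l) ≠ 0 := pow_ne_zero _ (Nat.cast_ne_zero.mpr hl.ne_zero)
    -- Here `S = lℤ + (τ + i)ℤ = l⁻¹J_i`, with denominators cleared. The identity also gives the
    -- invertibility of `J_i`.
    have heq : Ideal.span {lα} * idealJ h2 hO hτ l i = Ideal.span {(l ^ 2 : suborder O l)} * I.1 := by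
      ext x
      simp only [Ideal.mem_span_singleton_mul]
      constructor
      · rintro ⟨y, ⟨a, b, hy⟩, rfl⟩
        obtain ⟨z, hz, hza⟩ := hadd (hlO a 0) (hmul b hτi)
        refine ⟨z, hz, Subtype.ext ?_⟩
        change (l : K) ^ 2 * z = l * α * y
        rw [hza, hy]
        push_cast
        ring
      · rintro ⟨z, hz, rfl⟩
        obtain ⟨a, b, hab⟩ := hS z hz
        obtain ⟨k, hk⟩ := hcoord a b ⟨z, hz, hab⟩
        have hk' : (a : K) - b * i = l * k := by exact_mod_cast congrArg (Int.cast : ℤ → K) hk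
        refine ⟨⟨l ^ 2 * k + l * (τ + i) * b, 0, ((l * k + i * b : ℤ) : K) + b * τ,
          add_mul_mem hτ _ _, by push_cast; ring⟩, ⟨_, _, rfl⟩, Subtype.ext ?_⟩
        change l * α * (l ^ 2 * k + l * (τ + i) * b) = (l : K) ^ 2 * z
        rw [hab]
        linear_combination - (l : K) ^ 2 * α * hk'
    have hinv : IsInvertible (suborder O l) (idealJ h2 hO hτ l i) :=
      (isInvertible_mul_iff.mp (heq ▸ isInvertible_mul_iff.mpr
        ⟨isInvertible_span_singleton hl2, I.2⟩)).2
    exact ⟨some ⟨⟨i, hil⟩, hinv⟩, idealClass_eq_iff.mpr ⟨lα, l ^ 2, hlα, hl2, heq⟩⟩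
  · push Not at hcase
    have hdvd : ∀ b c : ℤ, S (b + c * τ) → (l : ℤ) ∣ c := fun b c h => by
      by_contra hc
      exact hcase b c hc h
    -- All `τ`-coordinates in `S` are divisible by `l`: if `1 ∈ S` then `S = R`; otherwise `S ⊆ lO`
    -- and `αO = IO ⊆ lαO`, which is absurd.
    by_cases hS1 : S 1
    · refine ⟨none, ?_⟩
      obtain ⟨x, hx, hxα⟩ := hS1
      rw [mul_one] at hxα
      have hx0 : x ≠ 0 := by
        rintro rfl
        exact hα' hxα.symm
      refine (idealClass_idealL O hl.ne_zero).trans (idealClass_eq_one_iff.mpr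
        ⟨x, hx0, le_antisymm (fun z hz => ?_) ((Ideal.span_singleton_le_iff_mem _).mpr hx)⟩).symm
      obtain ⟨b, c, hbc⟩ := hS z hz
      rw [Ideal.mem_span_singleton']
      refine ⟨⟨b + c * τ, (add_mul_mem_suborder_iff h2 hO hτ).mpr (hdvd b c ⟨z, hz, hbc⟩)⟩,
        Subtype.ext ?_⟩
      change (b + c * τ) * (x : K) = z
      rw [hbc, ← hxα, mul_comm]
    · exfalso
      have hle : I.1.map (algebraMap (suborder O l) O) ≤ Ideal.span {(l : O) * α} := by
        rw [Ideal.map_le_iff_le_comap]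
        intro x hx
        obtain ⟨b, c, hbc⟩ := hS x hx
        obtain ⟨k, rfl⟩ := hdvd b c ⟨x, hx, hbc⟩
        have hb : (l : ℤ) ∣ b := by
          by_contra hb
          refine hS1 (hone b ?_ hb)
          have h := hadd ⟨x, hx, hbc⟩ (hlO 0 (-k))
          convert h using 1
          push_cast
          ring
        obtain ⟨m, rfl⟩ := hb
        rw [Ideal.mem_comap, Ideal.mem_span_singleton']
        refine ⟨⟨_, add_mul_mem hτ m k⟩, Subtype.ext ?_⟩
        change _ * ((l : K) * α) = (x : K)
        rw [hbc]
        push_cast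
        ring
      rw [hI, Ideal.span_singleton_le_iff_mem, Ideal.mem_span_singleton'] at hle
      obtain ⟨o, ho⟩ := hle
      obtain ⟨a, b, hab⟩ := exists_eq_add_mul h2 hO hτ o.2
      have h1 : (o : K) * (l * α) = α := congrArg Subtype.val ho
      have h3 : (o : K) * l = 1 := mul_right_cancel₀ hα' (by rw [mul_assoc, h1, one_mul])
      rw [hab] at h3
      have h4 := (add_mul_inj h2 hO hτ (a := l * a) (b := l * b) (c := 1) (d := 0)
        (by push_cast; linear_combination h3)).1
      exact hlZ.not_isUnit (isUnit_of_dvd_one ⟨a, h4.symm⟩)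

end Kernel

/-! ### The representatives are distinct and fill the kernel -/

section Representatives

variable {K : Type*} [Field K] [NumberField K] {O : Subalgebra ℤ K} {τ : K}

omit [NumberField K] in
theorem map_span_natCast {N : ℕ} (m : ℕ) :
    (Ideal.span {(m : suborder O N)}).map (algebraMap (suborder O N) O) =
      Ideal.span {(m : O)} := by
  rw [Ideal.map_span, Set.image_singleton, map_natCast]

variable (h2 : Module.finrank ℚ K = 2) (hO : IsOrder O) (hτ : O = Algebra.adjoin ℤ {τ})

theorem map_representative {l : ℕ} (hl : l.Prime)
    (r : Option {i : Fin l // IsInvertible (suborder O l) (idealJ h2 hO hτ l i)}) :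
    (representative h2 hO hτ hl.ne_zero r).1.map (algebraMap (suborder O l) O) =
      Ideal.span {(l : O)} := by
  cases r with
  | none => exact map_span_natCast l
  | some i => exact map_idealJ h2 hO hτ hl i.2

theorem natCast_notMem_idealJ {l : ℕ} (hl : l.Prime) (i : ℕ) :
    (l : suborder O l) ∉ idealJ h2 hO hτ l i := by
  rintro ⟨a, b, h⟩
  have h' : (l : K) = l ^ 2 * a + l * (τ + i) * b := h
  obtain ⟨h1, hb⟩ := add_mul_inj h2 hO hτ (a := l ^ 2 * a + l * i * b) (b := l * b) (c := l)
    (d := 0) (by push_cast; linear_combination -h')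
  have hl0 : (l : ℤ) ≠ 0 := Nat.cast_ne_zero.mpr hl.ne_zero
  obtain rfl : b = 0 := (mul_eq_zero.mp hb).resolve_left hl0
  refine (Nat.prime_iff_prime_int.mp hl).not_isUnit
    (isUnit_of_dvd_one ⟨a, mul_left_cancel₀ hl0 ?_⟩)
  linear_combination -h1

theorem eq_of_idealJ_eq {l : ℕ} (hl : l ≠ 0) {i j : Fin l}
    (h : idealJ h2 hO hτ l i = idealJ h2 hO hτ l j) : i = j := by
  have hmem : (⟨l * (τ + (i : ℕ)), 0, τ + (i : ℕ),
      O.add_mem (generator_mem hτ) (natCast_mem O i), by simp⟩ : suborder O l) ∈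
      idealJ h2 hO hτ l i := ⟨0, 1, by simp⟩
  rw [h] at hmem
  obtain ⟨a, b, hab⟩ := hmem
  have hab' : (l : K) * (τ + (i : ℕ)) = l ^ 2 * a + l * (τ + (j : ℕ)) * b := hab
  have hl0 : (l : ℤ) ≠ 0 := Nat.cast_ne_zero.mpr hl
  obtain ⟨h1, hb⟩ := add_mul_inj h2 hO hτ (a := l ^ 2 * a + l * (j : ℕ) * b) (b := l * b)
    (c := l * (i : ℕ)) (d := l) (by push_cast; linear_combination -hab')
  obtain rfl : b = 1 := mul_left_cancel₀ hl0 (by rw [hb, mul_one])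
  have h3 : ((i : ℕ) : ℤ) - (j : ℕ) = l * a := mul_left_cancel₀ hl0 (by linear_combination -h1)
  exact Fin.ext (Nat.ModEq.eq_of_lt_of_lt
    ((Int.natCast_modEq_iff).mp (Int.modEq_iff_dvd.mpr ⟨a, h3⟩)) j.2 i.2).symm

theorem representative_injective (hd : NumberField.discr K < -4) {l : ℕ} (hl : l.Prime) :
    Function.Injective fun r => idealClass (representative h2 hO hτ hl.ne_zero r) := by
  intro r s hrs
  have h := eq_of_idealClass_eq h2 hd hO (Nat.cast_ne_zero.mpr hl.ne_zero)
    (map_representative h2 hO hτ hl r) (map_representative h2 hO hτ hl s) hrs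
  rcases r with _ | i <;> rcases s with _ | j
  · rfl
  · refine absurd ?_ (natCast_notMem_idealJ h2 hO hτ hl j.1)
    exact (congrArg (fun I : Ideal (suborder O l) => (l : suborder O l) ∈ I) h).mp
      (Ideal.mem_span_singleton_self _)
  · refine absurd ?_ (natCast_notMem_idealJ h2 hO hτ hl i.1)
    exact (congrArg (fun I : Ideal (suborder O l) => (l : suborder O l) ∈ I) h).mpr
      (Ideal.mem_span_singleton_self _)
  · exact congrArg some (Subtype.ext (eq_of_idealJ_eq h2 hO hτ hl.ne_zero h))

theorem range_representative {l : ℕ} (hl : l.Prime) :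
    (Set.range fun r => idealClass (representative h2 hO hτ hl.ne_zero r)) =
      ((classMap O l).ker : Set (ClassGroup (suborder O l))) := by
  ext c
  rw [SetLike.mem_coe, MonoidHom.mem_ker]
  constructor
  · rintro ⟨r, rfl⟩
    exact (extendedHom_idealClass _).trans (idealClass_eq_one_iff.mpr
      ⟨(l : O), Nat.cast_ne_zero.mpr hl.ne_zero, map_representative h2 hO hτ hl r⟩)
  · intro hc
    obtain ⟨I, rfl⟩ := idealClass_surjective c
    obtain ⟨α, hα, hI⟩ := idealClass_eq_one_iff.mp ((extendedHom_idealClass I).symm.trans hc)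
    exact exists_representative h2 hO hτ hl I hα hI

/-- If `J_i ^ n` is principal, then `(τ + i) ^ n` lies in `ℤ + l O`. -/
theorem pow_mem_suborder (hd : NumberField.discr K < -4) {l : ℕ} (hl : l.Prime) {i : ℕ}
    (hi : IsInvertible (suborder O l) (idealJ h2 hO hτ l i)) {n : ℕ}
    (h : idealClass ⟨_, hi⟩ ^ n = 1) : (τ + i) ^ n ∈ suborder O l := by
  have hl0 : ((l ^ n : ℕ) : suborder O l) ≠ 0 :=
    Nat.cast_ne_zero.mpr (pow_ne_zero _ hl.ne_zero)
  -- Both sides extend to `l^n O` and have trivial class.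
  have hJ : idealJ h2 hO hτ l i ^ n = Ideal.span {((l ^ n : ℕ) : suborder O l)} := by
    refine eq_of_idealClass_eq h2 hd hO (I := ⟨_, hi.pow n⟩)
      (J := ⟨_, isInvertible_span_singleton hl0⟩) (c := ((l ^ n : ℕ) : O))
      (Nat.cast_ne_zero.mpr (pow_ne_zero _ hl.ne_zero)) ?_ (map_span_natCast _) ?_
    · rw [Ideal.map_pow, map_idealJ h2 hO hτ hl hi, Ideal.span_singleton_pow, Nat.cast_pow]
    · rw [← idealClass_pow hi, h]
      exact (idealClass_eq_one_iff.mpr ⟨_, hl0, rfl⟩).symm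
  have hmem : (⟨l * (τ + i), 0, τ + i,
      O.add_mem (generator_mem hτ) (natCast_mem O i), by simp⟩ : suborder O l) ∈
      idealJ h2 hO hτ l i := ⟨0, 1, by simp⟩
  have hpow := Ideal.pow_mem_pow hmem n
  rw [hJ, Ideal.mem_span_singleton'] at hpow
  obtain ⟨r, hr⟩ := hpow
  have hr' : (r : K) * ((l ^ n : ℕ) : K) = (l * (τ + i)) ^ n := congrArg Subtype.val hr
  have hlK : (l : K) ^ n ≠ 0 := pow_ne_zero _ (Nat.cast_ne_zero.mpr hl.ne_zero)
  have : (r : K) = (τ + i) ^ n := by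
    apply mul_right_cancel₀ hlK
    rw [Nat.cast_pow] at hr'
    rw [hr', mul_pow, mul_comm]
  exact this ▸ r.2

end Representatives

/-! ### The kernel is cyclic -/

section Cyclic

open Polynomial

/-- The coefficients of `(X + τ) ^ (n + 1)` in the basis `1, τ`. -/
theorem exists_polynomial_pow_eq {A : Type*} [CommRing A] {τ : A} {t m : ℤ}
    (h : τ ^ 2 = t * τ + m) (n : ℕ) : ∃ P Q : ℤ[X], P.natDegree ≤ n + 1 ∧ P.coeff (n + 1) = 1 ∧
      Q.natDegree ≤ n ∧ Q.coeff n = n + 1 ∧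
      ∀ x : ℤ, (τ + x) ^ (n + 1) = (P.eval x : ℤ) + (Q.eval x : ℤ) * τ := by
  induction n with
  | zero =>
    refine ⟨X, 1, by simp, by simp, by simp, by simp, fun x => by simp; ring⟩
  | succ n ih =>
    obtain ⟨P, Q, hP, hP1, hQ, hQ1, hev⟩ := ih
    -- The product `(P + Qτ)(X + τ)`, reduced by `τ² = tτ + m`.
    refine ⟨X * P + C m * Q, P + X * Q + C t * Q, ?_, ?_, ?_, ?_, fun x => ?_⟩
    · compute_degree
      omega
    · rw [coeff_add, coeff_X_mul, hP1, coeff_C_mul,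
        coeff_eq_zero_of_natDegree_lt (p := Q) (by omega)]
      ring
    · compute_degree
      omega
    · rw [coeff_add, coeff_add, coeff_X_mul, hP1, hQ1, coeff_C_mul,
        coeff_eq_zero_of_natDegree_lt (p := Q) (by omega)]
      push_cast
      ring
    · rw [pow_succ, hev]
      simp only [eval_add, eval_mul, eval_X, eval_C]
      push_cast
      linear_combination ((Q.eval x : ℤ) : A) * h

/-- The set consists of the roots mod `l` of the `τ`-coordinate of `(τ + X)^n`, nonzero because its
coefficient `n` is prime to `l`. The strict bound leaves room for the trivial class. -/
theorem exists_finset_forall_mem {K : Type*} [Field K] [NumberField K] {O : Subalgebra ℤ K}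
    {τ : K} (h2 : Module.finrank ℚ K = 2) (hO : IsOrder O) (hτ : O = Algebra.adjoin ℤ {τ})
    {l : ℕ} (hl : l.Prime) {n : ℕ} (hn : 0 < n) (hnl : n < l) :
    ∃ T : Finset (ZMod l), T.card < n ∧
      ∀ i : ℕ, (τ + i) ^ n ∈ suborder O l → (i : ZMod l) ∈ T := by
  have : Fact l.Prime := ⟨hl⟩
  obtain ⟨t, m, htm⟩ := exists_quadratic h2 (hO.isIntegral τ (generator_mem hτ))
  obtain ⟨n, rfl⟩ := Nat.exists_eq_succ_of_ne_zero hn.ne'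
  obtain ⟨P, Q, -, -, hQ, hQ1, hev⟩ := exists_polynomial_pow_eq htm n
  have hne : Q.map (Int.castRingHom (ZMod l)) ≠ 0 := by
    intro h0
    have h1 := congrArg (fun p => p.coeff n) h0
    simp only [coeff_map, hQ1, coeff_zero] at h1
    have h3 : ((n + 1 : ℕ) : ZMod l) = 0 := by simpa using h1
    rw [ZMod.natCast_eq_zero_iff] at h3
    exact absurd (Nat.le_of_dvd (Nat.succ_pos n) h3) (by omega)
  refine ⟨(Q.map (Int.castRingHom (ZMod l))).roots.toFinset, ?_, fun i hi => ?_⟩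
  · have h1 := Multiset.toFinset_card_le (Q.map (Int.castRingHom (ZMod l))).roots
    have h3 := card_roots' (Q.map (Int.castRingHom (ZMod l)))
    have h4 := natDegree_map_le (f := Int.castRingHom (ZMod l)) (p := Q)
    omega
  · rw [Multiset.mem_toFinset, mem_roots hne, IsRoot.def]
    have h1 := hev i
    rw [Int.cast_natCast] at h1
    rw [h1, add_mul_mem_suborder_iff h2 hO hτ] at hi
    have h3 := (ZMod.intCast_zmod_eq_zero_iff_dvd _ l).mpr hi
    have h4 : (Int.castRingHom (ZMod l)) (i : ℤ) = (i : ZMod l) := by simp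
    rw [← h4, eval_map, eval₂_hom]
    exact h3

/-- A finite group `G` is cyclic if `a ^ n = 1` has at most `n` solutions for each proper divisor
`n` of the order of `G`. -/
theorem isCyclic_of_card_pow_eq_one_le_of_dvd {G : Type*} [Group G] [Fintype G] [DecidableEq G]
    (h : ∀ n, n ∣ Fintype.card G → n < Fintype.card G →
      (Finset.univ.filter fun a : G => a ^ n = 1).card ≤ n) : IsCyclic G := by
  refine isCyclic_of_card_pow_eq_one_le fun n hn => ?_
  have hgcd : (Finset.univ.filter fun a : G => a ^ n = 1) =
      Finset.univ.filter fun a : G => a ^ n.gcd (Fintype.card G) = 1 := by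
    ext a
    simp only [Finset.mem_filter, Finset.mem_univ, true_and, ← orderOf_dvd_iff_pow_eq_one,
      Nat.dvd_gcd_iff, orderOf_dvd_card, and_true]
  rw [hgcd]
  refine le_trans ?_ (Nat.gcd_le_left (Fintype.card G) hn)
  rcases (Nat.gcd_le_right n (Fintype.card_pos (α := G))).lt_or_eq with hlt | heq
  · exact h _ (Nat.gcd_dvd_right _ _) hlt
  · rw [heq]
    exact Finset.card_le_univ _

theorem isCyclic_ker_classMap {K : Type*} [Field K] [NumberField K] {O : Subalgebra ℤ K}
    {τ : K} (h2 : Module.finrank ℚ K = 2) (hd : NumberField.discr K < -4) (hO : IsOrder O)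
    (hτ : O = Algebra.adjoin ℤ {τ}) {l : ℕ} (hl : l.Prime) : IsCyclic (classMap O l).ker := by
  classical
  have : Fact l.Prime := ⟨hl⟩
  have hex : ∀ g : (classMap O l).ker, ∃ r,
      idealClass (representative h2 hO hτ hl.ne_zero r) = (g : ClassGroup (suborder O l)) :=
    fun g => (range_representative h2 hO hτ hl).ge g.2
  choose ρ hρ using hex
  have hρinj : Function.Injective ρ := fun a b hab =>
    Subtype.ext (by rw [← hρ a, ← hρ b, hab])
  let f : (classMap O l).ker → Option (Fin l) := fun g => (ρ g).map Subtype.val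
  have hf : Function.Injective f :=
    (Option.map_injective Subtype.val_injective).comp hρinj
  have : Fintype (classMap O l).ker := Fintype.ofInjective f hf
  have hcard : Fintype.card (classMap O l).ker ≤ l + 1 := by
    simpa using Fintype.card_le_of_injective f hf
  refine isCyclic_of_card_pow_eq_one_le_of_dvd fun n hdvd hlt => ?_
  have hn : 0 < n := Nat.pos_of_dvd_of_pos hdvd Fintype.card_pos
  -- A proper divisor is at most `(l + 1)/2`.
  have hnl : n < l := by
    obtain ⟨k, hk⟩ := hdvd
    have hk2 : 2 ≤ k := by
      by_contra hk1
      interval_cases k <;> omega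
    have := Nat.mul_le_mul_left n hk2
    have := hl.two_le
    omega
  obtain ⟨T, hT, hTmem⟩ := exists_finset_forall_mem h2 hO hτ hl hn hnl
  have hcast : Function.Injective fun i : Fin l => ((i : ℕ) : ZMod l) := fun i j hij =>
    Fin.ext (Nat.ModEq.eq_of_lt_of_lt ((ZMod.natCast_eq_natCast_iff _ _ _).mp hij) i.2 j.2)
  -- The extra element `none` accounts for the class of `lR`.
  have hle := Finset.card_le_card_of_injOn (s := Finset.univ.filter fun a => a ^ n = 1)
    (t := Finset.insertNone T) (fun g => (f g).map fun i : Fin l => ((i : ℕ) : ZMod l)) ?_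
    ((Option.map_injective hcast).comp hf).injOn
  · rw [Finset.card_insertNone] at hle
    omega
  · intro g hg
    have hg1 : (g : ClassGroup (suborder O l)) ^ n = 1 :=
      congrArg Subtype.val (Finset.mem_filter.mp hg).2
    rw [← hρ g] at hg1
    rw [Finset.mem_coe, Finset.mem_insertNone]
    intro x hx
    simp only [f, Option.mem_def, Option.map_eq_some_iff] at hx
    obtain ⟨_, ⟨i, hi, rfl⟩, rfl⟩ := hx
    rw [hi] at hg1
    exact hTmem _ (pow_mem_suborder h2 hO hτ hd hl i.2 hg1)

end Cyclic

/-! ### Indices of the representatives -/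

section Norm

theorem natCard_quotient_of_surjective {A M : Type*} [CommRing A] [AddCommGroup M] {I : Ideal A}
    (f : A →+ M) (hf : Function.Surjective f) (hI : ∀ x, x ∈ I ↔ f x = 0) :
    Nat.card (A ⧸ I) = Nat.card M := by
  have hker : I.toAddSubgroup = f.ker := by
    ext x
    exact hI x
  refine Nat.card_congr ((QuotientAddGroup.quotientAddEquivOfEq hker).trans
    (QuotientAddGroup.quotientKerEquivOfSurjective f hf)).toEquiv

variable {K : Type*} [Field K] [NumberField K] {O : Subalgebra ℤ K} {τ : K}
  (h2 : Module.finrank ℚ K = 2) (hO : IsOrder O) (hτ : O = Algebra.adjoin ℤ {τ})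

include h2 hO hτ

theorem exists_suborder_equiv {l : ℕ} (hl : l ≠ 0) :
    ∃ e : suborder O l ≃+ ℤ × ℤ, ∀ x : suborder O l, (x : K) = (e x).1 + l * (e x).2 * τ := by
  have hl0 : (l : ℤ) ≠ 0 := Nat.cast_ne_zero.mpr hl
  let f : ℤ × ℤ →+ suborder O l :=
    { toFun := fun p => ⟨(p.1 : ℤ) + (l * p.2 : ℤ) * τ,
        (add_mul_mem_suborder_iff h2 hO hτ).mpr (dvd_mul_right _ _)⟩
      map_zero' := Subtype.ext (by simp)
      map_add' := fun p q => Subtype.ext (by push_cast; simp; ring) }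
  have hf : Function.Bijective f := by
    constructor
    · intro p q hpq
      obtain ⟨h1, h3⟩ := add_mul_inj h2 hO hτ (congrArg Subtype.val hpq)
      exact Prod.ext h1 (mul_left_cancel₀ hl0 h3)
    · rintro ⟨x, hx⟩
      obtain ⟨a, b, rfl⟩ := exists_eq_add_mul h2 hO hτ (suborder_le O l hx)
      obtain ⟨c, rfl⟩ := (add_mul_mem_suborder_iff h2 hO hτ).mp hx
      exact ⟨(a, c), rfl⟩
  refine ⟨(AddEquiv.ofBijective f hf).symm, fun x => ?_⟩
  obtain ⟨p, rfl⟩ := hf.2 x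
  have : (AddEquiv.ofBijective f hf).symm (f p) = p :=
    (AddEquiv.ofBijective f hf).symm_apply_apply p
  rw [this]
  change (p.1 : K) + (l * p.2 : ℤ) * τ = _
  push_cast
  rfl

theorem natCard_quotient_representative {l : ℕ} (hl : l ≠ 0)
    (r : Option {i : Fin l // IsInvertible (suborder O l) (idealJ h2 hO hτ l i)}) :
    Nat.card (suborder O l ⧸ (representative h2 hO hτ hl r).1) = l ^ 2 := by
  obtain ⟨e, he⟩ := exists_suborder_equiv h2 hO hτ hl
  have hl0 : (l : ℤ) ≠ 0 := Nat.cast_ne_zero.mpr hl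
  cases r with
  | none =>
    have h := natCard_quotient_of_surjective (I := (representative h2 hO hτ hl none).1)
      (((Int.castAddHom (ZMod l)).prodMap (Int.castAddHom (ZMod l))).comp e.toAddMonoidHom)
      (((ZMod.intCast_surjective).prodMap (ZMod.intCast_surjective)).comp e.surjective) ?_
    · rw [h, Nat.card_prod, Nat.card_zmod, sq]
    · intro x
      change x ∈ Ideal.span {(l : suborder O l)} ↔
        (((e x).1 : ZMod l), ((e x).2 : ZMod l)) = 0
      rw [Prod.mk_eq_zero, ZMod.intCast_zmod_eq_zero_iff_dvd, ZMod.intCast_zmod_eq_zero_iff_dvd,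
        Ideal.mem_span_singleton']
      constructor
      · rintro ⟨y, rfl⟩
        rw [mul_comm, ← nsmul_eq_mul, map_nsmul]
        simp
      · rintro ⟨⟨a, ha⟩, ⟨b, hb⟩⟩
        refine ⟨e.symm (a, b), e.injective ?_⟩
        rw [mul_comm, ← nsmul_eq_mul, map_nsmul, e.apply_symm_apply]
        ext <;> simp [ha, hb]
  | some i =>
    have hadd : ∀ x y : suborder O l, e (x + y) = e x + e y := map_add e
    -- Subtracting `b · l(τ + i)` from `a + blτ` leaves `a - ilb`, which must be a multiple of `l²`
    -- for membership in `J_i`.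
    let g : suborder O l →+ ZMod (l ^ 2) :=
      { toFun := fun x => (((e x).1 - (i.1 : ℕ) * (l * (e x).2) : ℤ) : ZMod (l ^ 2))
        map_zero' := by simp
        map_add' := fun x y => by simp [hadd]; ring }
    have h := natCard_quotient_of_surjective (I := (representative h2 hO hτ hl (some i)).1) g ?_ ?_
    · rw [h, Nat.card_zmod]
    · intro z
      obtain ⟨a, rfl⟩ := ZMod.intCast_surjective z
      refine ⟨e.symm (a, 0), ?_⟩
      change (((e (e.symm (a, 0))).1 - (i.1 : ℕ) * (l * (e (e.symm (a, 0))).2) : ℤ) :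
        ZMod (l ^ 2)) = a
      simp
    · intro x
      change (∃ a b : ℤ, (x : K) = l ^ 2 * a + l * (τ + (i.1 : ℕ)) * b) ↔
        (((e x).1 - (i.1 : ℕ) * (l * (e x).2) : ℤ) : ZMod (l ^ 2)) = 0
      rw [ZMod.intCast_zmod_eq_zero_iff_dvd, he]
      constructor
      · rintro ⟨a, b, hab⟩
        obtain ⟨h1, h3⟩ := add_mul_inj h2 hO hτ (a := (e x).1) (b := l * (e x).2)
          (c := l ^ 2 * a + l * (i.1 : ℕ) * b) (d := l * b)
          (by push_cast; linear_combination hab)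
        refine ⟨a, ?_⟩
        rw [h1, h3]
        push_cast
        ring
      · rintro ⟨a, ha⟩
        refine ⟨a, (e x).2, ?_⟩
        have ha' : ((e x).1 : K) - (i.1 : ℕ) * (l * (e x).2) = l ^ 2 * a := by
          exact_mod_cast congrArg (Int.cast : ℤ → K) ha
        linear_combination ha'

end Norm

end QuadOrder

/-- `K` is a quadratic field of discriminant `d_K < -4`, `O = ℤ[τ]` an order of `K` of conductor prime
to the prime `l`, `R = ℤ + l O`, and `φ : cl(R) → cl(O)`, `[I] ↦ [I O]`. Then `l R` and the invertible
`J_i` represent each class of `ker φ` exactly once, and `ker φ` is generated by the class of an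
invertible `R`-ideal of norm `[R : I] = l²`. -/
theorem mainTheorem7 {K : Type*} [Field K] [NumberField K]
    (h2 : Module.finrank ℚ K = 2) (hd : NumberField.discr K < -4)
    (O : Subalgebra ℤ K) (hO : QuadOrder.IsOrder O)
    (τ : K) (hτ : O = Algebra.adjoin ℤ {τ})
    (l : ℕ) (hl : l.Prime) (hcop : Nat.Coprime l (QuadOrder.conductor O)) :
    (Function.Injective fun r =>
        QuadOrder.idealClass (QuadOrder.representative h2 hO hτ hl.ne_zero r)) ∧
      (Set.range fun r =>
        QuadOrder.idealClass (QuadOrder.representative h2 hO hτ hl.ne_zero r)) =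
          ((QuadOrder.classMap O l).ker : Set (ClassGroup (QuadOrder.suborder O l))) ∧
      ∃ I : QuadOrder.InvertibleIdeal (QuadOrder.suborder O l),
        Nat.card (QuadOrder.suborder O l ⧸ I.1) = l ^ 2 ∧
        Subgroup.zpowers (QuadOrder.idealClass I) = (QuadOrder.classMap O l).ker := by
  refine ⟨QuadOrder.representative_injective h2 hO hτ hd hl,
    QuadOrder.range_representative h2 hO hτ hl, ?_⟩
  have := QuadOrder.isCyclic_ker_classMap h2 hd hO hτ hl
  obtain ⟨⟨g, hg⟩, hgen⟩ := IsCyclic.exists_generator (α := (QuadOrder.classMap O l).ker)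
  -- A generator is itself the class of a representative, and all of these have index `l²`.
  obtain ⟨r, hr⟩ := (QuadOrder.range_representative h2 hO hτ hl).ge hg
  refine ⟨QuadOrder.representative h2 hO hτ hl.ne_zero r,
    QuadOrder.natCard_quotient_representative h2 hO hτ hl.ne_zero r, ?_⟩
  have hr' : QuadOrder.idealClass (QuadOrder.representative h2 hO hτ hl.ne_zero r) = g := hr
  rw [hr']
  refine le_antisymm ((Subgroup.zpowers_le).mpr hg) fun x hx => ?_
  obtain ⟨k, hk⟩ := hgen ⟨x, hx⟩
  exact ⟨k, congrArg Subtype.val hk⟩
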